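/- Let $G$ be a discrete group and let $(K_n)_{n\in\mathbb N}$ be an approximating sequence for $G$, that is, a sequence of normal subgroups of finite index with $K_n\supseteq K_{n+1}$ for all $n$ and $\bigcap_n K_n=\{e\}$. Put $G_n=G/K_n$ with quotient map $q_n:G\to G_n$ for $n\in\mathbb N$, and $G_\infty=G$, $q_\infty=\mathrm{id}_G$. Let $\mathbb N_*=\mathbb N\cup\{\infty\}$ be the one-point compactification of $\mathbb N$, and let $\mathcal G=\bigsqcup_{n\in\mathbb N_*}\{n\}\times G_n$ be the associated HLS groupoid: the group bundle over $\mathbb N_*$ with the topology generated by the singletons $\{(n,g)\}$ ($n\in\mathbb N$, $g\in G_n$) and the sets $\{(m,q_m(g)) : m\in\mathbb N_*,\ m\ge n\}$ ($g\in G$, $n\in\mathbb N$). Its unit space $\{(n,e)\}$ is identified with $\mathbb N_*$. Let $\mathfrak H=(\{\mathfrak H_n\}_{n\in\mathbb N_*},\Gamma)$ be a continuous field of Hilbert spaces over $\mathbb N_*$, with space of continuous sections $\Gamma$, and let $\varpi$ be a continuous unitary representation of $\mathcal G$ on $\mathfrak H$: a family of unitaries $\varpi(x):\mathfrak H_{s(x)}\to\mathfrak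 H_{r(x)}$, $x\in\mathcal G$, with $\varpi(xy)=\varpi(x)\varpi(y)$ for composable $x,y$, and such that $x\mapsto\langle\varpi(x)\xi(s(x)),\eta(r(x))\rangle$ is continuous on $\mathcal G$ for all bounded continuous sections $\xi,\eta\in\Gamma$. For $n\in\mathbb N_*$ let $\pi^n$ be the unitary representation $g\mapsto\varpi(n,g)$ of $G_n$ on $\mathfrak H_n$. Then the representation $\pi^\infty$ of $G$ is weakly contained in the set of representations $\{\pi^n\circ q_n : n\in\mathbb N\}$; that is, extending unitary representations of $G$ to the full group $C^*$-algebra $C^*(G)$, $$\bigcap_{n\in\mathbb N}\ker_{C^*(G)}(\pi^n\circ q_n)\subseteq\ker_{C^*(G)}(\pi^\infty).$$ -/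

import Mathlib

universe u v w

noncomputable section

namespace HLS

/-! ### Unitary representations of a discrete group -/

/-- A unitary representation of the (discrete) group `G` on a Hilbert space.  As `G` carries the
discrete topology, every homomorphism into the unitary group is continuous. -/
structure UnitaryRep (G : Type u) [Group G] where
  space : Type v
  [normedAddCommGroup : NormedAddCommGroup space]
  [innerProductSpace : InnerProductSpace ℂ space]
  [completeSpace : CompleteSpace space]
  hom : G →* unitary (space →L[ℂ] space)

attribute [instance] UnitaryRep.normedAddCommGroup UnitaryRep.innerProductSpace
  UnitaryRep.completeSpace

/-- The representation `π ∘ q`. -/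
def UnitaryRep.comp {G : Type u} {Q : Type w} [Group G] [Group Q] (π : UnitaryRep.{w, v} Q)
    (q : G →* Q) : UnitaryRep.{u, v} G where
  space := π.space
  hom := π.hom.comp q

/-- The linear extension of `π` to the group algebra, `∑ c_g g ↦ ∑ c_g π(g)`. -/
def UnitaryRep.algHom {G : Type u} [Group G] (π : UnitaryRep.{u, v} G) :
    MonoidAlgebra ℂ G →ₐ[ℂ] (π.space →L[ℂ] π.space) :=
  MonoidAlgebra.lift ℂ _ G ((unitary (π.space →L[ℂ] π.space)).subtype.comp π.hom)

/-! ### The full group C*-algebra -/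

section GroupCStar

variable {G : Type u} [Group G]

/-- The involution `(∑ c_g g)^* = ∑ conj(c_g) g⁻¹` of the group algebra. -/
def groupAlgStar (f : MonoidAlgebra ℂ G) : MonoidAlgebra ℂ G :=
  f.coeff.sum fun g c => MonoidAlgebra.single g⁻¹ (star c)

/-- C*-seminorms on the *-algebra `ℂ[G]`. -/
structure IsCStarSeminorm (p : MonoidAlgebra ℂ G → ℝ) : Prop where
  nonneg : ∀ f, 0 ≤ p f
  add_le : ∀ f g, p (f + g) ≤ p f + p g
  smul_eq : ∀ (c : ℂ) f, p (c • f) = ‖c‖ * p f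
  mul_le : ∀ f g, p (f * g) ≤ p f * p g
  star_mul_self : ∀ f, p (groupAlgStar f * f) = p f ^ 2

theorem IsCStarSeminorm.single_le {p : MonoidAlgebra ℂ G → ℝ} (hp : IsCStarSeminorm p) (g : G)
    (c : ℂ) : p (MonoidAlgebra.single g c) ≤ ‖c‖ := by
  have h (g : G) : p (MonoidAlgebra.single 1 1) = p (MonoidAlgebra.single g 1) ^ 2 := by
    rw [← hp.star_mul_self]
    simp [groupAlgStar, MonoidAlgebra.single_mul_single]
  have h1 := h 1
  have h1' : p (MonoidAlgebra.single 1 1) ≤ 1 := by nlinarith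
  have h2 : p (MonoidAlgebra.single g 1) ≤ 1 := by nlinarith [h g]
  have h3 : (MonoidAlgebra.single g c : MonoidAlgebra ℂ G) = c • MonoidAlgebra.single g 1 := by
    simp
  rw [h3, hp.smul_eq]
  exact mul_le_of_le_one_right (norm_nonneg _) h2

theorem IsCStarSeminorm.map_zero {p : MonoidAlgebra ℂ G → ℝ} (hp : IsCStarSeminorm p) :
    p 0 = 0 := by
  simpa using hp.smul_eq 0 0

theorem IsCStarSeminorm.le_sum {p : MonoidAlgebra ℂ G → ℝ} (hp : IsCStarSeminorm p)
    (f : MonoidAlgebra ℂ G) : p f ≤ f.coeff.sum fun _ c => ‖c‖ := by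
  have hf : f = ∑ g ∈ f.coeff.support, MonoidAlgebra.single g (f.coeff g) := by
    conv_lhs => rw [← MonoidAlgebra.sum_coeff_single f]
    rfl
  have : p (∑ g ∈ f.coeff.support, MonoidAlgebra.single g (f.coeff g)) ≤
      ∑ g ∈ f.coeff.support, p (MonoidAlgebra.single g (f.coeff g)) :=
    Finset.le_sum_of_subadditive p hp.map_zero.le hp.add_le _ _
  rw [← hf] at this
  exact this.trans (Finset.sum_le_sum fun g _ => hp.single_le g _)

theorem isCStarSeminorm_zero : IsCStarSeminorm (fun _ : MonoidAlgebra ℂ G => (0 : ℝ)) := by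
  constructor <;> simp

/-- The largest C*-seminorm of `ℂ[G]`. -/
def maxNorm (f : MonoidAlgebra ℂ G) : ℝ :=
  sSup {r | ∃ p : MonoidAlgebra ℂ G → ℝ, IsCStarSeminorm p ∧ r = p f}

theorem IsCStarSeminorm.le_maxNorm {p : MonoidAlgebra ℂ G → ℝ} (hp : IsCStarSeminorm p)
    (f : MonoidAlgebra ℂ G) : p f ≤ maxNorm f :=
  le_csSup ⟨f.coeff.sum fun _ c => ‖c‖, by rintro _ ⟨q, hq, rfl⟩; exact hq.le_sum f⟩ ⟨p, hp, rfl⟩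

theorem maxNorm_le {f : MonoidAlgebra ℂ G} {C : ℝ}
    (h : ∀ p : MonoidAlgebra ℂ G → ℝ, IsCStarSeminorm p → p f ≤ C) : maxNorm f ≤ C :=
  csSup_le ⟨0, _, isCStarSeminorm_zero, rfl⟩ (by rintro _ ⟨q, hq, rfl⟩; exact h q hq)

theorem maxNorm_nonneg (f : MonoidAlgebra ℂ G) : 0 ≤ maxNorm f :=
  isCStarSeminorm_zero.le_maxNorm f

theorem isCStarSeminorm_maxNorm : IsCStarSeminorm (maxNorm (G := G)) where
  nonneg := maxNorm_nonneg
  add_le f g := maxNorm_le fun p hp =>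
    (hp.add_le f g).trans (add_le_add (hp.le_maxNorm f) (hp.le_maxNorm g))
  smul_eq c f := by
    apply le_antisymm
    · refine maxNorm_le fun p hp => ?_
      rw [hp.smul_eq]
      exact mul_le_mul_of_nonneg_left (hp.le_maxNorm f) (norm_nonneg _)
    · rcases eq_or_ne c 0 with rfl | hc
      · simpa using maxNorm_nonneg (0 : MonoidAlgebra ℂ G)
      · have hc' : 0 < ‖c‖ := norm_pos_iff.2 hc
        rw [← le_div_iff₀' hc']
        refine maxNorm_le fun p hp => ?_
        rw [le_div_iff₀' hc', ← hp.smul_eq]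
        exact hp.le_maxNorm _
  mul_le f g := maxNorm_le fun p hp => (hp.mul_le f g).trans
    (mul_le_mul (hp.le_maxNorm f) (hp.le_maxNorm g) (hp.nonneg g) (maxNorm_nonneg f))
  star_mul_self f := by
    apply le_antisymm
    · refine maxNorm_le fun p hp => ?_
      rw [hp.star_mul_self]
      exact pow_le_pow_left₀ (hp.nonneg f) (hp.le_maxNorm f) 2
    · have h : maxNorm f ≤ √(maxNorm (groupAlgStar f * f)) := maxNorm_le fun p hp => by
        apply Real.le_sqrt_of_sq_le
        rw [← hp.star_mul_self]
        exact hp.le_maxNorm _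
      calc maxNorm f ^ 2 ≤ √(maxNorm (groupAlgStar f * f)) ^ 2 :=
            pow_le_pow_left₀ (maxNorm_nonneg f) h 2
        _ = _ := Real.sq_sqrt (maxNorm_nonneg _)

theorem maxNorm_neg (f : MonoidAlgebra ℂ G) : maxNorm (-f) = maxNorm f := by
  rw [← neg_one_smul ℂ f, isCStarSeminorm_maxNorm.smul_eq, norm_neg, norm_one, one_mul]

variable (G) in
/-- The group algebra `ℂ[G]`, regarded as a seminormed algebra with its largest C*-seminorm. -/
def MaxGroupAlgebra : Type u := MonoidAlgebra ℂ G

instance : Ring (MaxGroupAlgebra G) := inferInstanceAs (Ring (MonoidAlgebra ℂ G))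

instance : Algebra ℂ (MaxGroupAlgebra G) := inferInstanceAs (Algebra ℂ (MonoidAlgebra ℂ G))

instance : SeminormedRing (MaxGroupAlgebra G) :=
  RingSeminorm.toSeminormedRing
    { toFun := fun f : MaxGroupAlgebra G => maxNorm (G := G) f
      map_zero' := isCStarSeminorm_maxNorm.map_zero
      add_le' := isCStarSeminorm_maxNorm.add_le
      neg' := maxNorm_neg
      mul_le' := isCStarSeminorm_maxNorm.mul_le }

instance : NormedAlgebra ℂ (MaxGroupAlgebra G) where
  norm_smul_le c f := (isCStarSeminorm_maxNorm.smul_eq (G := G) c f).le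

variable (G) in
/-- The full group C*-algebra `C*(G)` of the discrete group `G`: the enveloping C*-algebra of
`ℂ[G]`, that is, the completion of `ℂ[G]` in its largest C*-seminorm. -/
abbrev GroupCStar : Type u := UniformSpace.Completion (MaxGroupAlgebra G)

theorem UnitaryRep.algHom_single (π : UnitaryRep.{u, v} G) (g : G) (c : ℂ) :
    π.algHom (MonoidAlgebra.single g c) = c • (π.hom g : π.space →L[ℂ] π.space) := by
  simp [UnitaryRep.algHom]

theorem UnitaryRep.algHom_star (π : UnitaryRep.{u, v} G) (f : MonoidAlgebra ℂ G) :
    π.algHom (groupAlgStar f) = star (π.algHom f) := by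
  have h : π.algHom f =
      f.coeff.sum fun g c => c • (π.hom g : π.space →L[ℂ] π.space) := by
    conv_lhs => rw [← MonoidAlgebra.sum_coeff_single f]
    simp only [Finsupp.sum, map_sum, π.algHom_single]
  rw [h]
  simp only [groupAlgStar, Finsupp.sum, map_sum, star_sum, π.algHom_single, star_smul, map_inv]
  rfl

theorem UnitaryRep.isCStarSeminorm (π : UnitaryRep.{u, v} G) :
    IsCStarSeminorm (fun f => ‖π.algHom f‖) where
  nonneg f := norm_nonneg _
  add_le f g := by rw [map_add]; exact norm_add_le _ _
  smul_eq c f := by rw [map_smul, norm_smul]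
  mul_le f g := by rw [map_mul]; exact norm_mul_le _ _
  star_mul_self f := by
    rw [map_mul, π.algHom_star, CStarRing.norm_star_mul_self, sq]

/-- The linear extension of `π` to `ℂ[G]` as a continuous linear map. -/
def UnitaryRep.toCLM (π : UnitaryRep.{u, v} G) :
    MaxGroupAlgebra G →L[ℂ] (π.space →L[ℂ] π.space) :=
  LinearMap.mkContinuous (E := MaxGroupAlgebra G)
    { toFun := fun f => π.algHom f
      map_add' := π.algHom.map_add
      map_smul' := map_smul π.algHom } 1
    fun f => by
      rw [one_mul]
      exact π.isCStarSeminorm.le_maxNorm f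

/-- The extension of `π` to `C*(G)`: the unique continuous map on `C*(G)` which is
`∑ c_g g ↦ ∑ c_g π(g)` on `ℂ[G]`. -/
def UnitaryRep.extension (π : UnitaryRep.{u, v} G) :
    GroupCStar G →L[ℂ] (π.space →L[ℂ] π.space) :=
  π.toCLM.extend (UniformSpace.Completion.toComplL : MaxGroupAlgebra G →L[ℂ] GroupCStar G)

theorem UnitaryRep.extension_coe (π : UnitaryRep.{u, v} G) (f : MaxGroupAlgebra G) :
    π.extension (f : GroupCStar G) = π.algHom f :=
  ContinuousLinearMap.extend_eq π.toCLM
    (UniformSpace.Completion.denseRange_coe (α := MaxGroupAlgebra G))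
    (UniformSpace.Completion.isUniformInducing_coe (MaxGroupAlgebra G)) f

/-- The kernel of `π` in `C*(G)`. -/
def UnitaryRep.cstarKer (π : UnitaryRep.{u, v} G) : Set (GroupCStar G) :=
  {a | π.extension a = 0}

/-- `S` is weakly contained in `T`: `⋂_{τ ∈ T} ker τ ⊆ ⋂_{σ ∈ S} ker σ` in `C*(G)`. -/
def WeaklyContained (S : Set (UnitaryRep.{u, v} G)) (T : Set (UnitaryRep.{u, w} G)) : Prop :=
  ⋂ τ ∈ T, τ.cstarKer ⊆ ⋂ σ ∈ S, σ.cstarKer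

end GroupCStar

/-! ### Topological groupoids and their representations -/

/-- A topological groupoid with unit space `X` and space of arrows `𝒢`; a pair `(x, y)` is
composable when `src x = rng y`.  The unit space is identified with a subspace of `𝒢` through the
topological embedding `unit`. -/
class TopGroupoid (X : outParam (Type v)) (𝒢 : Type u) [TopologicalSpace X]
    [TopologicalSpace 𝒢] where
  src : 𝒢 → X
  rng : 𝒢 → X
  unit : X → 𝒢
  mul : ∀ x y : 𝒢, src x = rng y → 𝒢
  inv : 𝒢 → 𝒢
  src_unit : ∀ t, src (unit t) = t
  rng_unit : ∀ t, rng (unit t) = t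
  src_mul : ∀ x y h, src (mul x y h) = src y
  rng_mul : ∀ x y h, rng (mul x y h) = rng x
  src_inv : ∀ x, src (inv x) = rng x
  rng_inv : ∀ x, rng (inv x) = src x
  mul_assoc : ∀ x y z (h : src x = rng y) (h' : src y = rng z),
    mul (mul x y h) z ((src_mul x y h).trans h') = mul x (mul y z h') (h.trans (rng_mul y z h').symm)
  mul_unit : ∀ x, mul x (unit (src x)) (rng_unit _).symm = x
  unit_mul : ∀ x, mul (unit (rng x)) x (src_unit _) = x
  inv_mul : ∀ x, mul (inv x) x (src_inv x) = unit (src x)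
  mul_inv : ∀ x, mul x (inv x) (rng_inv x).symm = unit (rng x)
  isEmbedding_unit : Topology.IsEmbedding unit
  continuous_inv : Continuous inv
  continuous_mul : Continuous fun p : {p : 𝒢 × 𝒢 // src p.1 = rng p.2} => mul p.1.1 p.1.2 p.2

/-- A continuous Hilbert field over `T` with fibres `H t`; `Γ` is the space of continuous
sections. -/
structure ContinuousHilbertField (T : Type u) [TopologicalSpace T] (H : T → Type v)
    [∀ t, NormedAddCommGroup (H t)] [∀ t, InnerProductSpace ℂ (H t)]
    [∀ t, CompleteSpace (H t)] where
  Γ : Submodule ℂ (∀ t, H t)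
  dense : ∀ t, Dense {v : H t | ∃ ξ ∈ Γ, ξ t = v}
  continuous_norm : ∀ ξ ∈ Γ, Continuous fun t => ‖ξ t‖
  mem_of_locally_approx : ∀ ξ : ∀ t, H t,
    (∀ t, ∀ ε > 0, ∃ ξ' ∈ Γ, ∀ᶠ τ in nhds t, ‖ξ τ - ξ' τ‖ < ε) → ξ ∈ Γ

section Rep

variable {T : Type u} [TopologicalSpace T] {H : T → Type v} [∀ t, NormedAddCommGroup (H t)]
  [∀ t, InnerProductSpace ℂ (H t)] [∀ t, CompleteSpace (H t)]

/-- The bounded continuous sections. -/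
def ContinuousHilbertField.boundedSections (𝔥 : ContinuousHilbertField T H) : Set (∀ t, H t) :=
  {ξ | ξ ∈ 𝔥.Γ ∧ BddAbove (Set.range fun t => ‖ξ t‖)}

/-- The identity map between the fibres at equal points. -/
def fibreCast (H : T → Type v) [∀ t, NormedAddCommGroup (H t)] [∀ t, InnerProductSpace ℂ (H t)]
    {s t : T} (h : s = t) : H s ≃ₗᵢ[ℂ] H t :=
  Eq.rec (motive := fun t _ => H s ≃ₗᵢ[ℂ] H t) (LinearIsometryEquiv.refl ℂ (H s)) h

/-- A (continuous unitary) representation of the groupoid `𝒢` on a continuous Hilbert field over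
its unit space.  Mathlib's inner product is linear in its second argument. -/
structure GroupoidRep (𝒢 : Type w) [TopologicalSpace 𝒢] [TopGroupoid T 𝒢]
    (𝔥 : ContinuousHilbertField T H) where
  map : ∀ x : 𝒢, H (TopGroupoid.src x) ≃ₗᵢ[ℂ] H (TopGroupoid.rng x)
  continuous_coeff : ∀ ξ ∈ 𝔥.boundedSections, ∀ η ∈ 𝔥.boundedSections,
    Continuous fun x : 𝒢 =>
      inner ℂ (η (TopGroupoid.rng x)) (map x (ξ (TopGroupoid.src x)))
  map_mul : ∀ (x y : 𝒢) (h : TopGroupoid.src x = TopGroupoid.rng y)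
    (v : H (TopGroupoid.src (TopGroupoid.mul x y h))),
    map (TopGroupoid.mul x y h) v =
      fibreCast H (TopGroupoid.rng_mul x y h).symm
        (map x (fibreCast H h.symm (map y (fibreCast H (TopGroupoid.src_mul x y h) v))))

end Rep

/-! ### HLS groupoids -/

/-- An approximating sequence of the discrete group `G`. -/
structure ApproximatingSequence (G : Type u) [Group G] where
  K : ℕ → Subgroup G
  normal : ∀ n, (K n).Normal
  finiteIndex : ∀ n, (K n).FiniteIndex
  succ_le : ∀ n, K (n + 1) ≤ K n
  iInf_eq : ⨅ n, K n = ⊥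

namespace ApproximatingSequence

variable {G : Type u} [Group G] (A : ApproximatingSequence G)

instance (n : ℕ) : (A.K n).Normal := A.normal n

/-- The groups `G_n = G ⧸ K_n` for `n ∈ ℕ`, and `G_∞ = G`. -/
def Fibre : OnePoint ℕ → Type u
  | .infty => G
  | .some n => G ⧸ A.K n

instance : ∀ n, Group (A.Fibre n)
  | .infty => inferInstanceAs (Group G)
  | .some n => inferInstanceAs (Group (G ⧸ A.K n))

/-- The quotient maps `q_n : G → G_n`, with `q_∞` the identity. -/
def q : ∀ n, G →* A.Fibre n
  | .infty => MonoidHom.id G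
  | .some n => QuotientGroup.mk' (A.K n)

/-- The underlying set `⨆_{n ∈ ℕ ∪ {∞}} {n} × G_n` of the HLS groupoid. -/
@[ext]
structure HLSGroupoid where
  idx : OnePoint ℕ
  val : A.Fibre idx

/-- The ray `{(m, q_m(g)) : m ∈ ℕ ∪ {∞}, m ≥ n}`. -/
def ray (n : ℕ) (g : G) : Set A.HLSGroupoid :=
  {x | ∃ m : OnePoint ℕ, (m = .infty ∨ ∃ k : ℕ, n ≤ k ∧ m = .some k) ∧ x = ⟨m, A.q m g⟩}

/-- The topology generated by the singletons `{(n, g)}`, `n ∈ ℕ`, and by the rays. -/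
instance : TopologicalSpace A.HLSGroupoid :=
  TopologicalSpace.generateFrom
    ({s | ∃ (n : ℕ) (g : A.Fibre (.some n)), s = {⟨.some n, g⟩}} ∪ {s | ∃ n g, s = A.ray n g})

theorem isOpen_singleton (n : ℕ) (g : A.Fibre (.some n)) :
    IsOpen ({⟨.some n, g⟩} : Set A.HLSGroupoid) :=
  .basic _ (Or.inl ⟨n, g, rfl⟩)

theorem isOpen_ray (n : ℕ) (g : G) : IsOpen (A.ray n g) :=
  .basic _ (Or.inr ⟨n, g, rfl⟩)

theorem mem_ray_infty (n : ℕ) (g : G) : (⟨.infty, g⟩ : A.HLSGroupoid) ∈ A.ray n g :=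
  ⟨.infty, Or.inl rfl, rfl⟩

theorem ray_anti {n m : ℕ} (h : n ≤ m) (g : G) : A.ray m g ⊆ A.ray n g := by
  rintro _ ⟨k, hk | ⟨l, hl, hk⟩, rfl⟩
  · exact ⟨k, Or.inl hk, rfl⟩
  · exact ⟨k, Or.inr ⟨l, h.trans hl, hk⟩, rfl⟩

theorem exists_ray_subset {U : Set A.HLSGroupoid} (hU : IsOpen U) :
    ∀ g : G, (⟨.infty, g⟩ : A.HLSGroupoid) ∈ U → ∃ n, A.ray n g ⊆ U := by
  induction hU with
  | basic s hs =>
    intro g hg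
    rcases hs with ⟨n, k, rfl⟩ | ⟨n, k, rfl⟩
    · have h := congrArg HLSGroupoid.idx (Set.mem_singleton_iff.1 hg)
      exact absurd h (OnePoint.infty_ne_coe n)
    · obtain ⟨m, -, h⟩ := hg
      have hm : OnePoint.infty = m := congrArg HLSGroupoid.idx h
      subst hm
      have hgk : g = k := eq_of_heq (HLSGroupoid.ext_iff.1 h).2
      exact ⟨n, hgk ▸ subset_rfl⟩
  | univ => exact fun g _ => ⟨0, Set.subset_univ _⟩
  | inter s t _ _ hs ht =>
    intro g hg
    obtain ⟨n, hn⟩ := hs g hg.1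
    obtain ⟨m, hm⟩ := ht g hg.2
    exact ⟨max n m, Set.subset_inter ((A.ray_anti (le_max_left _ _) g).trans hn)
      ((A.ray_anti (le_max_right _ _) g).trans hm)⟩
  | sUnion S _ ih =>
    rintro g ⟨s, hs, hg⟩
    obtain ⟨n, hn⟩ := ih s hs g hg
    exact ⟨n, hn.trans (Set.subset_sUnion_of_mem hs)⟩

theorem continuousAt_coe {Y : Type*} [TopologicalSpace Y] (f : A.HLSGroupoid → Y) (n : ℕ)
    (g : A.Fibre (.some n)) : ContinuousAt f ⟨.some n, g⟩ := by
  have h : nhds (⟨.some n, g⟩ : A.HLSGroupoid) = pure _ :=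
    (isOpen_singleton_iff_nhds_eq_pure _).1 (A.isOpen_singleton n g)
  rw [ContinuousAt, h]
  exact tendsto_pure_nhds f _

/-- The composition of arrows in the group bundle. -/
def compArrow (x y : A.HLSGroupoid) (h : x.idx = y.idx) : A.HLSGroupoid :=
  ⟨y.idx, (Eq.rec (motive := fun t _ => A.Fibre t) x.val h : A.Fibre y.idx) * y.val⟩

theorem compArrow_mk (n : OnePoint ℕ) (a b : A.Fibre n) :
    A.compArrow ⟨n, a⟩ ⟨n, b⟩ rfl = ⟨n, a * b⟩ := rfl

theorem continuous_idx : Continuous (HLSGroupoid.idx : A.HLSGroupoid → OnePoint ℕ) := by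
  rw [continuous_iff_continuousAt]
  rintro ⟨_ | n, g⟩
  · rw [ContinuousAt, Filter.tendsto_def]
    intro s hs
    obtain ⟨t, ht, hts⟩ := OnePoint.hasBasis_nhds_infty.mem_iff.1 hs
    obtain ⟨N, hN⟩ := ht.2.finite_of_discrete.bddAbove
    refine Filter.mem_of_superset ((A.isOpen_ray (N + 1) g).mem_nhds (A.mem_ray_infty _ g)) ?_
    rintro _ ⟨m, hm | ⟨k, hk, hm⟩, rfl⟩ <;> subst hm <;> apply hts
    · exact Or.inr rfl
    · exact Or.inl ⟨k, fun hkt => by have := hN hkt; omega, rfl⟩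
  · exact A.continuousAt_coe _ n g

theorem continuous_one : Continuous fun n => (⟨n, 1⟩ : A.HLSGroupoid) := by
  rw [OnePoint.continuous_iff_from_nat, Filter.tendsto_def]
  intro s hs
  obtain ⟨U, hUs, hU, h1⟩ := mem_nhds_iff.1 hs
  obtain ⟨n, hn⟩ := A.exists_ray_subset hU 1 h1
  filter_upwards [Filter.eventually_ge_atTop n] with k hk
  exact hUs (hn ⟨k, Or.inr ⟨k, hk, rfl⟩, by rw [map_one]⟩)

theorem continuous_invArrow :
    Continuous fun x : A.HLSGroupoid => (⟨x.idx, x.val⁻¹⟩ : A.HLSGroupoid) := by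
  rw [continuous_iff_continuousAt]
  rintro ⟨_ | n, g⟩
  · rw [ContinuousAt, Filter.tendsto_def]
    intro s hs
    obtain ⟨U, hUs, hU, h1⟩ := mem_nhds_iff.1 hs
    obtain ⟨n, hn⟩ := A.exists_ray_subset hU _ h1
    refine Filter.mem_of_superset ((A.isOpen_ray n g).mem_nhds (A.mem_ray_infty _ g)) ?_
    rintro _ ⟨m, hm, rfl⟩
    refine hUs (hn ⟨m, hm, ?_⟩)
    exact congrArg (HLSGroupoid.mk m) (map_inv (A.q m) (show G from g)).symm
  · exact A.continuousAt_coe _ n g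

theorem continuous_compArrow :
    Continuous fun p : {p : A.HLSGroupoid × A.HLSGroupoid // p.1.idx = p.2.idx} =>
      A.compArrow p.1.1 p.1.2 p.2 := by
  rw [continuous_iff_continuousAt]
  rintro ⟨⟨⟨n, a⟩, ⟨n', b⟩⟩, h⟩
  obtain rfl : n = n' := h
  rw [ContinuousAt, Filter.tendsto_def]
  intro s hs
  rw [nhds_subtype_eq_comap]
  cases n with
  | infty =>
    obtain ⟨U, hUs, hU, h1⟩ := mem_nhds_iff.1 hs
    obtain ⟨n, hn⟩ := A.exists_ray_subset hU _ h1
    refine ⟨A.ray n a ×ˢ A.ray n b, ((A.isOpen_ray n a).prod (A.isOpen_ray n b)).mem_nhds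
      ⟨A.mem_ray_infty n a, A.mem_ray_infty n b⟩, ?_⟩
    rintro ⟨⟨_, _⟩, h⟩ ⟨⟨m, hm, rfl⟩, ⟨m', hm', rfl⟩⟩
    obtain rfl : m = m' := h
    refine hUs (hn ⟨m, hm, ?_⟩)
    exact congrArg (HLSGroupoid.mk m) (map_mul (A.q m) a b).symm
  | coe n =>
    refine ⟨{⟨.some n, a⟩} ×ˢ {⟨.some n, b⟩},
      ((A.isOpen_singleton n a).prod (A.isOpen_singleton n b)).mem_nhds
        (Set.mk_mem_prod rfl rfl), ?_⟩
    rintro ⟨⟨_, _⟩, h⟩ ⟨h1, h2⟩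
    obtain rfl := Set.mem_singleton_iff.1 h1
    obtain rfl := Set.mem_singleton_iff.1 h2
    exact (mem_of_mem_nhds hs :)

/-- The HLS groupoid as a topological groupoid: the group bundle over `ℕ ∪ {∞}`, with unit space
`{(n, e) : n ∈ ℕ ∪ {∞}}`. -/
instance : TopGroupoid (OnePoint ℕ) A.HLSGroupoid where
  src := HLSGroupoid.idx
  rng := HLSGroupoid.idx
  unit n := ⟨n, 1⟩
  mul := A.compArrow
  inv x := ⟨x.idx, x.val⁻¹⟩
  src_unit _ := rfl
  rng_unit _ := rfl
  src_mul _ _ _ := rfl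
  rng_mul _ _ h := h.symm
  src_inv _ := rfl
  rng_inv _ := rfl
  mul_assoc := by
    rintro ⟨n, a⟩ ⟨m, b⟩ ⟨l, c⟩ h h'
    obtain rfl : n = m := h
    obtain rfl : n = l := h'
    simp [compArrow_mk, mul_assoc]
  mul_unit := by
    rintro ⟨n, a⟩
    simp [compArrow_mk]
  unit_mul := by
    rintro ⟨n, a⟩
    simp [compArrow_mk]
  inv_mul := by
    rintro ⟨n, a⟩
    simp [compArrow_mk]
  mul_inv := by
    rintro ⟨n, a⟩
    simp [compArrow_mk]
  isEmbedding_unit := Function.LeftInverse.isEmbedding (f := HLSGroupoid.idx) (fun _ => rfl)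
    A.continuous_idx A.continuous_one
  continuous_inv := A.continuous_invArrow
  continuous_mul := A.continuous_compArrow

end ApproximatingSequence

/-- The restriction `π^n` of a representation `ϖ` of an HLS groupoid to the fibre `G_n`:
`π^n(g) = ϖ(n, g)`. -/
def GroupoidRep.restrict {G : Type u} [Group G] {A : ApproximatingSequence G}
    {H : OnePoint ℕ → Type v} [∀ t, NormedAddCommGroup (H t)]
    [∀ t, InnerProductSpace ℂ (H t)] [∀ t, CompleteSpace (H t)]
    {𝔥 : ContinuousHilbertField (OnePoint ℕ) H} (ϖ : GroupoidRep A.HLSGroupoid 𝔥)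
    (n : OnePoint ℕ) : UnitaryRep.{u, v} (A.Fibre n) where
  space := H n
  hom := Unitary.linearIsometryEquiv.symm.toMonoidHom.comp
    (MonoidHom.mk' (G := H n ≃ₗᵢ[ℂ] H n)
      (fun g : A.Fibre n => (ϖ.map (⟨n, g⟩ : A.HLSGroupoid) : H n ≃ₗᵢ[ℂ] H n))
      fun a b => LinearIsometryEquiv.ext fun v => ϖ.map_mul ⟨n, a⟩ ⟨n, b⟩ rfl v)

end HLS

end

namespace HLS

/-! For fixed `a` in `C*(G)` and sections `ξ`, `η` in `Γ`, the coefficient `n ↦ ⟨η n, (π^n ∘ q_n)(a)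
ξ n⟩` is continuous on `ℕ ∪ {∞}`. For a group element this is the continuity of `ϖ` along the
section `n ↦ (n, q_n(g))` of the groupoid (`continuous_q`). Linearity extends it to `ℂ[G]`
(`continuous_coeff_coe`), and uniform approximation to `C*(G)` (`continuous_coeff_extension`),
because all the `π^n ∘ q_n` are contractive. If `a` is killed at every finite `n`, its coefficients
vanish on `ℕ`, which is dense, hence also at `∞`. Since sections in `Γ` take a dense set of values
in `H ∞`, the operator of `a` there is zero. -/

/-- The canonical map `ℂ[G] → C*(G)`. -/
noncomputable def toGroupCStar {G : Type u} [Group G] : MonoidAlgebra ℂ G →+ GroupCStar G :=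
  (UniformSpace.Completion.toCompl : MaxGroupAlgebra G →+ GroupCStar G)

/-- On `ℂ[G]` the operator norm under `π` is a C*-seminorm, hence at most the largest one; the
closed condition passes to the completion. The bound does not depend on `π`, which makes the later
approximation uniform in `n`. -/
theorem UnitaryRep.norm_extension_le {G : Type u} [Group G] (π : UnitaryRep.{u, v} G)
    (a : GroupCStar G) : ‖π.extension a‖ ≤ ‖a‖ := by
  induction a using UniformSpace.Completion.induction_on with
  | hp => exact isClosed_le (by fun_prop) (by fun_prop)
  | ih f =>
    rw [π.extension_coe, UniformSpace.Completion.norm_coe]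
    exact π.isCStarSeminorm.le_maxNorm f

/-- Over a compact base every continuous section is bounded. -/
theorem ContinuousHilbertField.mem_boundedSections {T : Type u} [TopologicalSpace T]
    [CompactSpace T] {H : T → Type v} [∀ t, NormedAddCommGroup (H t)]
    [∀ t, InnerProductSpace ℂ (H t)] [∀ t, CompleteSpace (H t)]
    (𝔥 : ContinuousHilbertField T H) {ξ : ∀ t, H t} (hξ : ξ ∈ 𝔥.Γ) : ξ ∈ 𝔥.boundedSections :=
  ⟨hξ, (isCompact_range (𝔥.continuous_norm ξ hξ)).bddAbove⟩

/-- Only the point at infinity matters. A neighbourhood of `(∞, g)` contains a ray through `g`, and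
a ray is a tail of this very section. -/
theorem ApproximatingSequence.continuous_q {G : Type u} [Group G] (A : ApproximatingSequence G)
    (g : G) : Continuous fun n => (⟨n, A.q n g⟩ : A.HLSGroupoid) := by
  rw [OnePoint.continuous_iff_from_nat, Filter.tendsto_def]
  intro s hs
  obtain ⟨U, hUs, hU, h1⟩ := mem_nhds_iff.1 hs
  obtain ⟨n, hn⟩ := A.exists_ray_subset hU g h1
  filter_upwards [Filter.eventually_ge_atTop n] with k hk
  exact hUs (hn ⟨k, Or.inr ⟨k, hk, rfl⟩, rfl⟩)

/-! ### Continuity of matrix coefficients over `ℕ ∪ {∞}` -/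

section Coefficient

variable {G : Type u} [Group G] {A : ApproximatingSequence G} {H : OnePoint ℕ → Type v}
  [∀ t, NormedAddCommGroup (H t)] [∀ t, InnerProductSpace ℂ (H t)] [∀ t, CompleteSpace (H t)]
  {𝔥 : ContinuousHilbertField (OnePoint ℕ) H} (ϖ : GroupoidRep A.HLSGroupoid 𝔥)

/-- The operator of `a ∈ C*(G)` under `π^n ∘ q_n`, on the fibre `H n`. -/
noncomputable def GroupoidRep.fibreOp (n : OnePoint ℕ) : GroupCStar G →L[ℂ] (H n →L[ℂ] H n) :=
  ((ϖ.restrict n).comp (A.q n)).extension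

theorem GroupoidRep.norm_fibreOp_le (n : OnePoint ℕ) (a : GroupCStar G) :
    ‖ϖ.fibreOp n a‖ ≤ ‖a‖ :=
  ((ϖ.restrict n).comp (A.q n)).norm_extension_le a

theorem GroupoidRep.fibreOp_single (n : OnePoint ℕ) (g : G) (c : ℂ) (v : H n) :
    ϖ.fibreOp n (toGroupCStar (MonoidAlgebra.single g c)) v =
      c • (ϖ.map (⟨n, A.q n g⟩ : A.HLSGroupoid) : H n ≃ₗᵢ[ℂ] H n) v := by
  have h := ((ϖ.restrict n).comp (A.q n)).extension_coe
    (MonoidAlgebra.single g c : MonoidAlgebra ℂ G)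
  rw [UnitaryRep.algHom_single] at h
  exact DFunLike.congr_fun h v

theorem GroupoidRep.continuous_coeff_coe {ξ η : ∀ t, H t} (hξ : ξ ∈ 𝔥.Γ) (hη : η ∈ 𝔥.Γ)
    (f : MonoidAlgebra ℂ G) :
    Continuous fun n => inner ℂ (η n) (ϖ.fibreOp n (toGroupCStar f) (ξ n)) := by
  induction f using MonoidAlgebra.induction_linear with
  | zero =>
    simpa using continuous_const
  | add f g hf hg =>
    refine (hf.add hg).congr fun n => ?_
    simp only [map_add, add_apply, inner_add_right, Pi.add_apply]
  | single g c =>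
    have h := (ϖ.continuous_coeff ξ (𝔥.mem_boundedSections hξ) η
      (𝔥.mem_boundedSections hη)).comp (A.continuous_q g)
    refine (continuous_const.mul h : Continuous fun n => c * _).congr fun n => ?_
    rw [ϖ.fibreOp_single, inner_smul_right]
    rfl

/-- The coefficient of `a` is a uniform limit of coefficients of elements of `ℂ[G]`: replacing `a`
by `f` changes it by at most `D * ‖a - f‖ * C` at every `n`, where `C` and `D` bound `ξ` and `η`. -/
theorem GroupoidRep.continuous_coeff_extension {ξ η : ∀ t, H t} (hξ : ξ ∈ 𝔥.Γ) (hη : η ∈ 𝔥.Γ)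
    (a : GroupCStar G) : Continuous fun n => inner ℂ (η n) (ϖ.fibreOp n a (ξ n)) := by
  obtain ⟨C, hC⟩ := (𝔥.mem_boundedSections hξ).2
  obtain ⟨D, hD⟩ := (𝔥.mem_boundedSections hη).2
  have hC (n) : ‖ξ n‖ ≤ C := hC ⟨n, rfl⟩
  have hD (n) : ‖η n‖ ≤ D := hD ⟨n, rfl⟩
  have hC0 : 0 ≤ C := (norm_nonneg _).trans (hC .infty)
  have hD0 : 0 ≤ D := (norm_nonneg _).trans (hD .infty)
  refine continuous_of_uniform_approx_of_continuous fun u hu => ?_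
  obtain ⟨ε, hε, hεu⟩ := Metric.mem_uniformity_dist.1 hu
  -- The `+ 1` keeps the denominator positive when `D * C = 0`.
  obtain ⟨f, hf⟩ := (UniformSpace.Completion.denseRange_coe
    (α := MaxGroupAlgebra G)).exists_dist_lt a (ε := ε / (D * C + 1)) (by positivity)
  change dist a (toGroupCStar (f : MonoidAlgebra ℂ G)) < _ at hf
  refine ⟨_, ϖ.continuous_coeff_coe hξ hη f, fun n => hεu ?_⟩
  rw [dist_eq_norm, lt_div_iff₀ (by positivity)] at hf
  rw [dist_eq_norm, ← inner_sub_right, ← sub_apply, ← map_sub]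
  generalize a - toGroupCStar (f : MonoidAlgebra ℂ G) = b at hf ⊢
  calc ‖inner ℂ (η n) (ϖ.fibreOp n b (ξ n))‖
      ≤ ‖η n‖ * ‖ϖ.fibreOp n b (ξ n)‖ := norm_inner_le_norm _ _
    _ ≤ D * (‖b‖ * C) := by
        gcongr
        · exact hD n
        · exact (ϖ.fibreOp n b).le_of_opNorm_le_of_le (ϖ.norm_fibreOp_le n b) (hC n)
    _ ≤ ‖b‖ * (D * C + 1) := by nlinarith [norm_nonneg b]
    _ < ε := hf

theorem GroupoidRep.fibreOp_infty_eq_zero {a : GroupCStar G}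
    (ha : ∀ n : ℕ, ϖ.fibreOp (.some n) a = 0) : ϖ.fibreOp .infty a = 0 := by
  have h0 {ξ η : ∀ t, H t} (hξ : ξ ∈ 𝔥.Γ) (hη : η ∈ 𝔥.Γ) :
      inner ℂ (η .infty) (ϖ.fibreOp .infty a (ξ .infty)) = 0 := by
    -- `ℕ` is not compact, so it is dense in its one-point compactification; a continuous function
    -- vanishing on it vanishes at `∞`.
    refine congrFun ((OnePoint.denseRange_coe (X := ℕ)).equalizer
      (ϖ.continuous_coeff_extension hξ hη a) (continuous_const (y := (0 : ℂ)))
      (funext fun n => ?_)) .infty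
    change inner ℂ (η (.some n)) (ϖ.fibreOp (.some n) a (ξ (.some n))) = 0
    rw [ha n, zero_apply, inner_zero_right]
  have h1 {ξ : ∀ t, H t} (hξ : ξ ∈ 𝔥.Γ) : ϖ.fibreOp .infty a (ξ .infty) = 0 :=
    (𝔥.dense .infty).eq_zero_of_inner_right ℂ fun v hv => by
      obtain ⟨η, hη, rfl⟩ := hv
      exact h0 hξ hη
  -- Density of the section values is used a second time, now for the argument of the operator
  -- instead of the vector paired with its value.
  refine ContinuousLinearMap.coeFn_injective (Continuous.ext_on (𝔥.dense .infty)
    (ϖ.fibreOp .infty a).continuous continuous_zero ?_)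
  rintro _ ⟨ξ, hξ, rfl⟩
  exact h1 hξ

end Coefficient

end HLS

theorem mainTheorem10 {G : Type u} [Group G] (A : HLS.ApproximatingSequence G)
    {H : OnePoint ℕ → Type v} [∀ t, NormedAddCommGroup (H t)]
    [∀ t, InnerProductSpace ℂ (H t)] [∀ t, CompleteSpace (H t)]
    (𝔥 : HLS.ContinuousHilbertField (OnePoint ℕ) H)
    (ϖ : HLS.GroupoidRep A.HLSGroupoid 𝔥) :
    HLS.WeaklyContained {(ϖ.restrict .infty).comp (A.q .infty)}
      (Set.range fun n : ℕ => (ϖ.restrict (.some n)).comp (A.q (.some n))) := by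
  intro a ha
  simp only [Set.mem_iInter, Set.mem_singleton_iff, forall_eq, Set.forall_mem_range] at ha ⊢
  -- Membership in `cstarKer` is by definition the vanishing of `fibreOp`.
  exact ϖ.fibreOp_infty_eq_zero ha
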